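/- Let $\{X_t\}_{t\ge 1}$ be a time-homogeneous Markov chain, with arbitrary initial distribution, on a measurable state space $\mathcal X$ with transition kernel $\mathcal P$. Assume it is uniformly ergodic with (necessarily unique) stationary distribution $\mu$, i.e. $\mu$ is $\mathcal P$-invariant and $\sup_{x\in\mathcal X}\|\mathcal P^t(x,\cdot)-\mu\|_{TV}\to 0$ as $t\to\infty$. Let $\tilde A:\mathcal X\to\mathbb R^{d\times d}$ and $\tilde b:\mathcal X\to\mathbb R^d$ be measurable with $\sup_{x}\|\tilde A(x)\|_F<\infty$ and $\sup_x\|\tilde b(x)\|_2<\infty$, and suppose that the limits $\bar A=\lim_{t\to\infty}\mathbb E[\tilde A(X_t)]$ and $\bar b=\lim_{t\to\infty}\mathbb E[\tilde b(X_t)]$ exist and that $\bar A$ is Hurwitz (all its complex eigenvalues have strictly negative real parts; in particular $\bar A$ has full rank). Let $\alpha_t=\alpha_0/t^{\eta}$ for $t\ge1$, with $\alpha_0>0$ and $\eta\in(1/2,1)$, and let $\{\theta_t\}_{t\ge0}$ be given by an arbitrary (possibly random) initial value $\theta_0\in\mathbb R^d$ and $$\theta_{t+1}=\theta_t+\alpha_{t+1}\bigl(\tilde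 A(X_{t+1})\theta_t-\tilde b(X_{t+1})\bigr),\qquad t\ge 0.$$ Then the equation $\bar A\theta=\bar b$ has a unique solution $\theta_*\in\mathbb R^d$, and for every $\gamma\in(0,\eta-1/2)$, almost surely $\|\theta_t-\theta_*\|_2=o(t^{-\gamma})$ as $t\to\infty$. In particular, almost surely the sequence $\{\theta_t\}_{t\ge 0}$ is bounded (although the update involves no projection step). -/

import Mathlib

open MeasureTheory ProbabilityTheory Filter Topology Asymptotics
open scoped ENNReal Matrix

namespace LSA

/-- Total variation distance `sup_B |ν B - μ B|`, the supremum running over the measurable sets.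
The total variation norm of the signed measure `ν - μ` (of probability measures) is twice this
number, so both give the same notion of convergence. -/
noncomputable def tvDist {S : Type*} [MeasurableSpace S] (ν μ : Measure S) : ℝ≥0∞ :=
  ⨆ (B : Set S) (_ : MeasurableSet B), ENNReal.ofReal |ν.real B - μ.real B|

/-- The transition kernel `P` is uniformly ergodic with stationary distribution `μ`: `μ` is
invariant under `P`, and the `t`-step transition probabilities `P ^ t` converge to `μ` in total
variation, uniformly in the starting state. (That `μ` is the only stationary distribution, and that
the convergence is geometric, are consequences and are not assumed.) -/
structure UniformlyErgodic {S : Type*} [MeasurableSpace S] (P : Kernel S S) (μ : Measure S) :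
    Prop where
  invariant : P.Invariant μ
  tendsto : Tendsto (fun t : ℕ => ⨆ x : S, tvDist ((P ^ t) x) μ) atTop (𝓝 0)

/-- The σ-algebra generated by `X 1, …, X t`. -/
@[reducible] def past {Ω S : Type*} [MeasurableSpace S] (X : ℕ → Ω → S) (t : ℕ) : MeasurableSpace Ω :=
  ⨆ s ∈ Set.Icc 1 t, MeasurableSpace.comap (X s) inferInstance

/-- `(X t)_{t ≥ 1}` is a time-homogeneous Markov chain with transition kernel `P` (and arbitrary
initial law) on the probability space `(Ω, Pr)`. The value `X 0` plays no role. -/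
structure IsMarkovChain {Ω S : Type*} [MeasurableSpace Ω] [MeasurableSpace S]
    (P : Kernel S S) (X : ℕ → Ω → S) (Pr : Measure Ω) : Prop where
  measurable : ∀ t, 1 ≤ t → Measurable (X t)
  markov : ∀ t, 1 ≤ t → ∀ B : Set S, MeasurableSet B →
    Pr[(X (t + 1) ⁻¹' B).indicator (fun _ => (1 : ℝ)) | past X t] =ᵐ[Pr]
      fun ω => (P (X t ω)).real B

/-- The Frobenius norm of a real matrix. -/
noncomputable def frobNorm {d : ℕ} (M : Matrix (Fin d) (Fin d) ℝ) : ℝ :=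
  Real.sqrt (∑ i, ∑ j, M i j ^ 2)

/-- A real square matrix is Hurwitz if all its complex eigenvalues have strictly negative real
part (in particular it then has full rank). -/
def IsHurwitz {d : ℕ} (M : Matrix (Fin d) (Fin d) ℝ) : Prop :=
  ∀ z : ℂ, Module.End.HasEigenvalue (Matrix.toLin' (M.map (algebraMap ℝ ℂ))) z → z.re < 0

/-- The action of a matrix on Euclidean space. -/
noncomputable def act {d : ℕ} (M : Matrix (Fin d) (Fin d) ℝ) (v : EuclideanSpace ℝ (Fin d)) :
    EuclideanSpace ℝ (Fin d) :=
  WithLp.toLp 2 (M *ᵥ v.ofLp)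

/-- The step sizes `α_t = α₀ / t ^ η`, used for `t ≥ 1`. -/
noncomputable def stepSize (α₀ η : ℝ) (t : ℕ) : ℝ := α₀ / (t : ℝ) ^ η

/-- The sequence `θ` runs the linear stochastic approximation update
`θ_{t+1} = θ_t + α_{t+1} (A(x_{t+1}) θ_t - b(x_{t+1}))` along the trajectory `x`. -/
def IsLSA {S : Type*} {d : ℕ} (A : S → Matrix (Fin d) (Fin d) ℝ)
    (b : S → EuclideanSpace ℝ (Fin d)) (α : ℕ → ℝ) (x : ℕ → S)
    (θ : ℕ → EuclideanSpace ℝ (Fin d)) : Prop :=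
  ∀ t : ℕ, θ (t + 1) = θ t + α (t + 1) • (act (A (x (t + 1))) (θ t) - b (x (t + 1)))

end LSA

/-! Put `Δ_k = θ_k - θ*`, so that `Δ_{k+1} = Δ_k + α_k (A_k Δ_k + e_k)`, where `A_k` and `e_k = A_k
θ* - b_k` have limiting means `Ā` and `0`.

Probability enters only through the tails `N_k = ∑_{j ≥ k} α_j (A_j - Ā)` and `n_k = ∑_{j ≥ k} α_j
e_j`, which are almost surely `O(k^{-κ})` for each `κ ∈ (0, η - 1/2)`
(`IsMarkovChain.ae_exists_tail`). Solving the Poisson equation (`UniformlyErgodic.exists_poisson`)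
splits the noise into martingale differences and a telescoping part. With weights `k^{-(η-κ)}`,
which are square summable, the partial sums are bounded; Abel summation against the remaining factor
`k^{-κ}` gives the tails.

The rest is deterministic (`exists_norm_le_mul_of_recursion`). The corrected iterate `ψ_k = Δ_k +
N_k Δ_k + n_k` satisfies `ψ_{k+1} = (I + α_k Ā) ψ_k + α_k R_k` with `R_k = O(k^{-κ} (1 + ‖Δ_k‖))`.
In a norm adapted to `Ā` (`IsHurwitz.exists_seminorm`) the first term contracts by `1 - c α_k`. The
part of the error proportional to `‖Δ_k‖` has a vanishing coefficient and is absorbed by the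
contraction, so neither a projection nor a prior bound on the iterates is needed. -/

namespace LSA

/-! ### Uniform ergodicity and the Poisson equation -/

section Kernel

variable {S : Type*} [MeasurableSpace S]

lemma integrable_of_abs_le {ν : Measure S} [IsFiniteMeasure ν] {f : S → ℝ} {c : ℝ}
    (hf : Measurable f) (hc : ∀ x, |f x| ≤ c) : Integrable f ν :=
  Integrable.of_bound hf.aestronglyMeasurable c (ae_of_all _ hc)

lemma abs_integral_le_of_abs_le {ν : Measure S} [IsProbabilityMeasure ν] {f : S → ℝ} {c : ℝ}
    (hc : ∀ x, |f x| ≤ c) : |∫ x, f x ∂ν| ≤ c := by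
  simpa using norm_integral_le_of_norm_le_const (μ := ν) (f := f) (C := c) (ae_of_all _ hc)

lemma abs_measureReal_sub_le_of_tvDist_le {ν μ : Measure S} {ε : ℝ} (hε : 0 ≤ ε)
    (h : tvDist ν μ ≤ ENNReal.ofReal ε) {B : Set S} (hB : MeasurableSet B) :
    |ν.real B - μ.real B| ≤ ε := by
  have : ENNReal.ofReal |ν.real B - μ.real B| ≤ ENNReal.ofReal ε :=
    le_trans (le_iSup₂ (f := fun (B : Set S) (_ : MeasurableSet B) =>
      ENNReal.ofReal |ν.real B - μ.real B|) B hB) h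
  exact (ENNReal.ofReal_le_ofReal_iff hε).1 this

/-- Layer cake: both integrals are integrals over `t ∈ (0, c]` of the measure of `{t ≤ f}`, and
these measures differ by at most `ε` for every `t`. -/
lemma abs_integral_sub_integral_le_of_nonneg {ν μ : Measure S} [IsProbabilityMeasure ν]
    [IsProbabilityMeasure μ] {ε : ℝ} (hε : 0 ≤ ε) (h : tvDist ν μ ≤ ENNReal.ofReal ε)
    {f : S → ℝ} {c : ℝ} (hf : Measurable f) (h0 : ∀ x, 0 ≤ f x) (hc : ∀ x, f x ≤ c)
    (hc0 : 0 ≤ c) : |∫ x, f x ∂ν - ∫ x, f x ∂μ| ≤ c * ε := by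
  have key : ∀ ρ : Measure S, IsProbabilityMeasure ρ →
      ∫ x, f x ∂ρ = ∫ t in Set.Ioc 0 c, ρ.real {a | t ≤ f a} ∧
      IntegrableOn (fun t => ρ.real {a | t ≤ f a}) (Set.Ioc 0 c) := by
    intro ρ _
    refine ⟨Integrable.integral_eq_integral_Ioc_meas_le
      (integrable_of_abs_le hf fun x => by rw [abs_of_nonneg (h0 x)]; exact hc x)
      (ae_of_all _ h0) (ae_of_all _ hc), ?_⟩
    refine Integrable.of_bound ?_ 1 (ae_of_all _ fun t => ?_)
    · have : Antitone fun t : ℝ => ρ.real {a | t ≤ f a} := fun s t hst =>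
        measureReal_mono fun a (ha : t ≤ f a) => hst.trans ha
      exact this.measurable.aestronglyMeasurable
    · rw [Real.norm_of_nonneg measureReal_nonneg]
      exact measureReal_le_one
  obtain ⟨h1, i1⟩ := key ν inferInstance
  obtain ⟨h2, i2⟩ := key μ inferInstance
  rw [h1, h2, ← integral_sub i1 i2]
  have := norm_setIntegral_le_of_norm_le_const (μ := volume) (s := Set.Ioc 0 c)
    (f := fun t => ν.real {a | t ≤ f a} - μ.real {a | t ≤ f a}) (C := ε) (by simp)
    (fun t _ => abs_measureReal_sub_le_of_tvDist_le hε h (measurableSet_le measurable_const hf))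
  rw [Real.norm_eq_abs] at this
  refine this.trans_eq ?_
  simp [Measure.real, hc0, mul_comm]

lemma abs_integral_sub_integral_le {ν μ : Measure S} [IsProbabilityMeasure ν]
    [IsProbabilityMeasure μ] {ε : ℝ} (hε : 0 ≤ ε) (h : tvDist ν μ ≤ ENNReal.ofReal ε)
    {f : S → ℝ} {c : ℝ} (hf : Measurable f) (hc : ∀ x, |f x| ≤ c) (hc0 : 0 ≤ c) :
    |∫ x, f x ∂ν - ∫ x, f x ∂μ| ≤ 2 * c * ε := by
  have := abs_integral_sub_integral_le_of_nonneg hε h (f := fun x => f x + c) (c := 2 * c)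
    (hf.add_const c) (fun x => by linarith [neg_le_of_abs_le (hc x)])
    (fun x => by linarith [le_of_abs_le (hc x)]) (by linarith)
  rwa [integral_add (integrable_of_abs_le hf hc) (integrable_const _),
    integral_add (integrable_of_abs_le hf hc) (integrable_const _), integral_const,
    integral_const, probReal_univ, probReal_univ, add_sub_add_right_eq_sub] at this

instance isMarkovKernel_pow (P : Kernel S S) [IsMarkovKernel P] (n : ℕ) :
    IsMarkovKernel (P ^ n) := by
  induction n with
  | zero => exact inferInstanceAs (IsMarkovKernel (Kernel.id : Kernel S S))
  | succ n ih =>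
    rw [Kernel.pow_add]
    simp only [pow_one]
    infer_instance

lemma measurable_integral_kernel (P : Kernel S S) [IsSFiniteKernel P] {f : S → ℝ}
    (hf : Measurable f) : Measurable fun x => ∫ y, f y ∂P x :=
  (hf.stronglyMeasurable.integral_kernel).measurable

lemma integral_bind_kernel {ν : Measure S} [IsFiniteMeasure ν] (P : Kernel S S)
    [IsMarkovKernel P] {f : S → ℝ} {c : ℝ} (hf : Measurable f) (hc : ∀ x, |f x| ≤ c) :
    ∫ y, f y ∂(ν.bind P) = ∫ x, ∫ y, f y ∂P x ∂ν := by
  have : (P ∘ₖ Kernel.const Unit ν) () = ν.bind P := by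
    rw [Kernel.comp_const]; simp
  have h2 := Kernel.integral_comp (κ := Kernel.const Unit ν) (η := P) (a := ()) (f := f)
    (integrable_of_abs_le hf hc)
  rwa [this, Kernel.const_apply] at h2

lemma integral_pow_add (P : Kernel S S) [IsMarkovKernel P] (m n : ℕ) (x : S) {f : S → ℝ} {c : ℝ}
    (hf : Measurable f) (hc : ∀ x, |f x| ≤ c) :
    ∫ y, f y ∂((P ^ (m + n)) x) = ∫ z, ∫ y, f y ∂((P ^ m) z) ∂((P ^ n) x) := by
  rw [Kernel.pow_add]
  exact Kernel.integral_comp (integrable_of_abs_le hf hc)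

lemma integral_pow_zero (P : Kernel S S) (x : S) {f : S → ℝ} (hf : Measurable f) :
    ∫ y, f y ∂((P ^ 0) x) = f x := by
  have : (P ^ 0) x = Measure.dirac x := by
    rw [pow_zero]; exact Kernel.id_apply x
  rw [this, integral_dirac' _ _ hf.stronglyMeasurable]

lemma integral_integral_pow_eq {P : Kernel S S} [IsMarkovKernel P] {μ : Measure S}
    [IsProbabilityMeasure μ] (hP : P.Invariant μ) (n : ℕ) {f : S → ℝ} {c : ℝ}
    (hf : Measurable f) (hc : ∀ x, |f x| ≤ c) :
    ∫ x, ∫ y, f y ∂((P ^ n) x) ∂μ = ∫ y, f y ∂μ := by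
  induction n with
  | zero => simp_rw [integral_pow_zero P _ hf]
  | succ n ih =>
    simp_rw [integral_pow_add P n 1 _ hf hc, pow_one]
    rw [← integral_bind_kernel P (measurable_integral_kernel (P ^ n) hf)
      (fun x => abs_integral_le_of_abs_le hc), hP.def, ih]

lemma UniformlyErgodic.exists_forall_tvDist_le {P : Kernel S S} {μ : Measure S}
    (hP : UniformlyErgodic P μ) {ε : ℝ} (hε : 0 < ε) :
    ∃ m, ∀ n ≥ m, ∀ x, tvDist ((P ^ n) x) μ ≤ ENNReal.ofReal ε := by
  obtain ⟨m, hm⟩ := eventually_atTop.1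
    (hP.tendsto.eventually (gt_mem_nhds (ENNReal.ofReal_pos.2 hε)))
  exact ⟨m, fun n hn x => (le_iSup (fun x => tvDist ((P ^ n) x) μ) x).trans (hm n hn).le⟩

/-- A kernel with a power contracting the centred bounded functions admits bounded solutions of
the Poisson equation. -/
lemma UniformlyErgodic.exists_poisson {P : Kernel S S} [IsMarkovKernel P] {μ : Measure S}
    [IsProbabilityMeasure μ] (hP : UniformlyErgodic P μ) {g : S → ℝ} {c : ℝ}
    (hg : Measurable g) (hc : ∀ x, |g x| ≤ c) (h0 : ∫ x, g x ∂μ = 0) :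
    ∃ (h : S → ℝ) (C : ℝ), Measurable h ∧ (∀ x, |h x| ≤ C) ∧
      ∀ x, h x - ∫ y, h y ∂P x = g x := by
  have hc0 : 0 ≤ c := by
    obtain ⟨x⟩ : Nonempty S := nonempty_of_isProbabilityMeasure μ
    exact (abs_nonneg _).trans (hc x)
  -- The value `1 / 4` turns the bound `2 * c * ε` into a factor `1 / 2` for every `m` steps;
  -- invariance keeps all iterates of `g` centred. No rate of ergodicity is required.
  obtain ⟨m, hm⟩ := hP.exists_forall_tvDist_le (ε := 1 / 4) (by norm_num)
  have hm := hm m le_rfl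
  have bound : ∀ k x, |∫ y, g y ∂((P ^ (m * k)) x)| ≤ c * (1 / 2) ^ k := by
    intro k
    induction k with
    | zero =>
      intro x
      rw [mul_zero, integral_pow_zero P x hg, pow_zero, mul_one]
      exact hc x
    | succ k ih =>
      intro x
      rw [mul_add, mul_one, integral_pow_add P _ _ x hg hc]
      have := abs_integral_sub_integral_le (ν := (P ^ m) x) (μ := μ) (by norm_num) (hm x)
        (measurable_integral_kernel (P ^ (m * k)) hg) ih (by positivity)
      rw [integral_integral_pow_eq hP.invariant _ hg hc, h0, sub_zero] at this
      refine this.trans_eq ?_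
      ring
  have sg : Summable fun k : ℕ => c * (1 / 2 : ℝ) ^ k :=
    (summable_geometric_of_lt_one (by norm_num) (by norm_num)).mul_left c
  have sm : ∀ x, Summable fun k : ℕ => ∫ y, g y ∂((P ^ (m * k)) x) := fun x =>
    Summable.of_norm_bounded sg fun k => bound k x
  -- The Neumann series for `I - P ^ m`.
  set H : S → ℝ := fun x => ∑' k : ℕ, ∫ y, g y ∂((P ^ (m * k)) x) with hH
  have Hm : Measurable H := by
    refine measurable_of_tendsto_metrizable (f := fun n x => ∑ k ∈ Finset.range n,
      ∫ y, g y ∂((P ^ (m * k)) x)) (fun n => Finset.measurable_sum _ fun k _ =>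
        measurable_integral_kernel (P ^ (m * k)) hg) ?_
    exact tendsto_pi_nhds.2 fun x => (sm x).hasSum.tendsto_sum_nat
  have Hb : ∀ x, |H x| ≤ ∑' k : ℕ, c * (1 / 2 : ℝ) ^ k := fun x =>
    by
    rw [← Real.norm_eq_abs]
    exact tsum_of_norm_bounded sg.hasSum fun k => bound k x
  have HP : ∀ x, H x - ∫ y, H y ∂((P ^ m) x) = g x := by
    intro x
    have e : ∫ y, H y ∂((P ^ m) x) = ∑' k : ℕ, ∫ y, g y ∂((P ^ (m * (k + 1))) x) := by
      rw [hH, ← integral_tsum_of_summable_integral_norm]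
      · refine tsum_congr fun k => ?_
        rw [mul_add, mul_one, integral_pow_add P _ _ x hg hc]
      · exact fun k => integrable_of_abs_le (measurable_integral_kernel (P ^ (m * k)) hg) (bound k)
      · refine Summable.of_nonneg_of_le (fun k => integral_nonneg fun y => norm_nonneg _)
          (fun k => ?_) sg
        refine (le_abs_self _).trans (abs_integral_le_of_abs_le fun y => ?_)
        rw [Real.norm_eq_abs, abs_abs]
        exact bound k y
    rw [e, hH]
    simp only
    rw [(sm x).tsum_eq_zero_add, add_sub_cancel_right, mul_zero, integral_pow_zero P x hg]
  -- Since `(I - P) ∑_{j < m} P ^ j = I - P ^ m`, summing the first `m` iterates of `H` solves the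
  -- equation for `P` itself.
  refine ⟨fun x => ∑ j ∈ Finset.range m, ∫ y, H y ∂((P ^ j) x),
    ∑ j ∈ Finset.range m, ∑' k : ℕ, c * (1 / 2 : ℝ) ^ k, Finset.measurable_sum _ fun j _ =>
      measurable_integral_kernel (P ^ j) Hm, fun x => (Finset.abs_sum_le_sum_abs _ _).trans
        (Finset.sum_le_sum fun j _ => abs_integral_le_of_abs_le Hb), fun x => ?_⟩
  rw [integral_finsetSum _ fun j _ => integrable_of_abs_le
    (measurable_integral_kernel (P ^ j) Hm) fun x => abs_integral_le_of_abs_le Hb]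
  have : ∀ j, ∫ y, ∫ z, H z ∂((P ^ j) y) ∂(P x) = ∫ z, H z ∂((P ^ (j + 1)) x) := fun j => by
    rw [integral_pow_add P j 1 x Hm Hb, pow_one]
  simp_rw [this]
  rw [← Finset.sum_sub_distrib, Finset.sum_range_sub', integral_pow_zero P x Hm, HP]

end Kernel

/-! ### The Markov property for functions, and limiting means -/

section Past

variable {Ω S : Type*} [MeasurableSpace S]

lemma past_mono (X : ℕ → Ω → S) : Monotone (past X) := fun _ _ h =>
  biSup_mono fun _ hr => ⟨hr.1, hr.2.trans h⟩

lemma measurable_past (X : ℕ → Ω → S) {s t : ℕ} (hs : 1 ≤ s) (hst : s ≤ t) :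
    Measurable[past X t] (X s) :=
  (comap_measurable (X s)).mono (le_iSup₂ (f := fun s (_ : s ∈ Set.Icc 1 t) =>
    MeasurableSpace.comap (X s) inferInstance) s ⟨hs, hst⟩) le_rfl

end Past

section Chain

variable {Ω S : Type*} [MeasurableSpace Ω] [MeasurableSpace S] {Pr : Measure Ω}
  {P : Kernel S S} {X : ℕ → Ω → S}

lemma IsMarkovChain.past_le (hX : IsMarkovChain P X Pr) (t : ℕ) :
    past X t ≤ (inferInstance : MeasurableSpace Ω) :=
  iSup₂_le fun s hs => (hX.measurable s hs.1).comap_le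

/-- Stated as an identity of measures, the Markov property passes from indicators to bounded
functions by a change of variables. -/
lemma IsMarkovChain.map_restrict [IsProbabilityMeasure Pr] [IsMarkovKernel P]
    (hX : IsMarkovChain P X Pr) {t : ℕ} (ht : 1 ≤ t) {B : Set Ω} (hB : MeasurableSet[past X t] B) :
    (Pr.restrict B).map (X (t + 1)) = ((Pr.restrict B).map (X t)).bind P := by
  ext C hC
  have hXt := hX.measurable t ht
  have hXt' := hX.measurable (t + 1) (by omega)
  rw [Measure.bind_apply hC P.measurable.aemeasurable, lintegral_map (P.measurable_coe hC) hXt,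
    Measure.map_apply hXt' hC]
  have h1 := setIntegral_condExp (μ := Pr) (hX.past_le t)
    (f := (X (t + 1) ⁻¹' C).indicator fun _ => (1 : ℝ))
    ((integrable_const 1).indicator (hXt' hC)) hB
  rw [setIntegral_congr_ae (hX.past_le t _ hB) ((hX.markov t ht C hC).mono fun ω h _ => h),
    integral_indicator_const _ (hXt' hC), smul_eq_mul, mul_one] at h1
  have h2 : ∫⁻ ω in B, P (X t ω) C ∂Pr = ENNReal.ofReal (∫ ω in B, (P (X t ω)).real C ∂Pr) := by
    rw [ofReal_integral_eq_lintegral_ofReal]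
    · exact lintegral_congr fun ω => by simp
    · refine Integrable.of_bound ?_ 1 (ae_of_all _ fun ω => ?_)
      · exact ((P.measurable_coe hC).ennreal_toReal.comp hXt).aestronglyMeasurable
      · rw [Real.norm_of_nonneg measureReal_nonneg]
        exact measureReal_le_one
    · exact ae_of_all _ fun ω => measureReal_nonneg
  rw [h2, h1]
  simp

/-- The Markov property for bounded measurable functions. -/
lemma IsMarkovChain.setIntegral_eq [IsProbabilityMeasure Pr] [IsMarkovKernel P]
    (hX : IsMarkovChain P X Pr) {t : ℕ} (ht : 1 ≤ t) {B : Set Ω} (hB : MeasurableSet[past X t] B)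
    {f : S → ℝ} {c : ℝ} (hf : Measurable f) (hc : ∀ x, |f x| ≤ c) :
    ∫ ω in B, f (X (t + 1) ω) ∂Pr = ∫ ω in B, ∫ y, f y ∂(P (X t ω)) ∂Pr := by
  have hXt := hX.measurable t ht
  have hXt' := hX.measurable (t + 1) (by omega)
  rw [← integral_map (μ := Pr.restrict B) hXt'.aemeasurable hf.aestronglyMeasurable,
    hX.map_restrict ht hB, integral_bind_kernel P hf hc,
    integral_map hXt.aemeasurable (measurable_integral_kernel P hf).aestronglyMeasurable]

lemma IsMarkovChain.condExp_eq [IsProbabilityMeasure Pr] [IsMarkovKernel P]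
    (hX : IsMarkovChain P X Pr) {t : ℕ} (ht : 1 ≤ t)
    {f : S → ℝ} {c : ℝ} (hf : Measurable f) (hc : ∀ x, |f x| ≤ c) :
    Pr[fun ω => f (X (t + 1) ω) | past X t] =ᵐ[Pr] fun ω => ∫ y, f y ∂(P (X t ω)) := by
  have hm : Measurable[past X t] fun ω => ∫ y, f y ∂(P (X t ω)) :=
    (measurable_integral_kernel P hf).comp (measurable_past X ht le_rfl)
  refine (ae_eq_condExp_of_forall_setIntegral_eq (hX.past_le t)
    (integrable_of_abs_le (hf.comp (hX.measurable (t + 1) (by omega))) fun ω => hc _)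
    (fun s _ _ => (integrable_of_abs_le (hm.mono (hX.past_le t) le_rfl)
      fun ω => abs_integral_le_of_abs_le hc).integrableOn)
    (fun s hs _ => (hX.setIntegral_eq ht hs hf hc).symm)
    hm.stronglyMeasurable.aestronglyMeasurable).symm

lemma IsMarkovChain.integral_eq [IsProbabilityMeasure Pr] [IsMarkovKernel P]
    (hX : IsMarkovChain P X Pr) (t : ℕ)
    {f : S → ℝ} {c : ℝ} (hf : Measurable f) (hc : ∀ x, |f x| ≤ c) :
    ∫ ω, f (X (t + 1) ω) ∂Pr = ∫ ω, ∫ y, f y ∂((P ^ t) (X 1 ω)) ∂Pr := by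
  induction t generalizing f with
  | zero => simp_rw [integral_pow_zero P _ hf]
  | succ t ih =>
    have := hX.setIntegral_eq (t := t + 1) (by omega) (MeasurableSet.univ) hf hc
    rw [setIntegral_univ, setIntegral_univ] at this
    rw [this, ih (measurable_integral_kernel P hf) fun x => abs_integral_le_of_abs_le hc]
    refine integral_congr_ae (ae_of_all _ fun ω => ?_)
    simp only
    rw [add_comm t 1, integral_pow_add P 1 t _ hf hc, pow_one]

/-- Identifies the limiting means with stationary means, so that the noise is centred under `μ` and
the Poisson equation applies. -/
lemma IsMarkovChain.tendsto_integral [IsProbabilityMeasure Pr] [IsMarkovKernel P]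
    {μ : Measure S} [IsProbabilityMeasure μ] (hP : UniformlyErgodic P μ)
    (hX : IsMarkovChain P X Pr) {f : S → ℝ} {c : ℝ} (hf : Measurable f) (hc : ∀ x, |f x| ≤ c) :
    Tendsto (fun t => ∫ ω, f (X t ω) ∂Pr) atTop (𝓝 (∫ x, f x ∂μ)) := by
  rw [← tendsto_add_atTop_iff_nat 1, Metric.tendsto_atTop]
  intro ε hε
  have hc0 : 0 ≤ c := by
    obtain ⟨x⟩ : Nonempty S := nonempty_of_isProbabilityMeasure μ
    exact (abs_nonneg _).trans (hc x)
  obtain ⟨m, hm⟩ := hP.exists_forall_tvDist_le (ε := ε / (4 * (c + 1))) (by positivity)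
  refine ⟨m, fun n hn => ?_⟩
  have hXm := hX.measurable 1 le_rfl
  have key : ∀ ω, |∫ y, f y ∂((P ^ n) (X 1 ω)) - ∫ x, f x ∂μ| ≤ ε / 2 := fun ω => by
    refine (abs_integral_sub_integral_le (by positivity) (hm n hn _) hf hc hc0).trans ?_
    rw [← mul_div_assoc, div_le_div_iff₀ (by positivity) (by norm_num)]
    nlinarith
  have i1 : Integrable (fun ω => ∫ y, f y ∂((P ^ n) (X 1 ω))) Pr :=
    integrable_of_abs_le ((measurable_integral_kernel (P ^ n) hf).comp hXm)
      fun ω => abs_integral_le_of_abs_le hc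
  have h2 := abs_integral_le_of_abs_le (ν := Pr) key
  rw [integral_sub i1 (integrable_const _), integral_const, probReal_univ, one_smul] at h2
  rw [Real.dist_eq, hX.integral_eq n hf hc]
  linarith

end Chain

/-! ### Martingales with square-summable increments -/

section Martingale

variable {Ω : Type*} {m0 : MeasurableSpace Ω} {Pr : Measure Ω}

/-- Orthogonality of martingale differences: the cross term vanishes on conditioning on `ℱ n`, with
respect to which the earlier sum is measurable. -/
lemma integral_sq_sum_le [IsProbabilityMeasure Pr] {ℱ : Filtration ℕ m0}
    {Y : ℕ → Ω → ℝ} {b : ℕ → ℝ} (hY : ∀ k, Measurable[ℱ (k + 1)] (Y k))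
    (hb : ∀ k ω, |Y k ω| ≤ b k) (h0 : ∀ k, Pr[Y k | ℱ k] =ᵐ[Pr] 0) (n : ℕ) :
    ∫ ω, (∑ k ∈ Finset.range n, Y k ω) ^ 2 ∂Pr ≤ ∑ k ∈ Finset.range n, b k ^ 2 := by
  have hY' : ∀ k, Measurable (Y k) := fun k => (hY k).mono (ℱ.le _) le_rfl
  have hM : ∀ n, Measurable[ℱ n] fun ω => ∑ k ∈ Finset.range n, Y k ω := fun n =>
    Finset.measurable_sum _ fun k hk =>
      (hY k).mono (ℱ.mono (Finset.mem_range.1 hk)) le_rfl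
  have hM' : ∀ n, Measurable fun ω => ∑ k ∈ Finset.range n, Y k ω := fun n =>
    (hM n).mono (ℱ.le _) le_rfl
  have hMb : ∀ n ω, |∑ k ∈ Finset.range n, Y k ω| ≤ ∑ k ∈ Finset.range n, b k := fun n ω =>
    (Finset.abs_sum_le_sum_abs _ _).trans (Finset.sum_le_sum fun k _ => hb k ω)
  induction n with
  | zero => simp
  | succ n ih =>
    set M : Ω → ℝ := fun ω => ∑ k ∈ Finset.range n, Y k ω with hMdef
    have iM2 : Integrable (fun ω => M ω ^ 2) Pr :=
      integrable_of_abs_le ((hM' n).pow_const 2) (c := (∑ k ∈ Finset.range n, b k) ^ 2) fun ω => by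
        rw [abs_pow]
        exact pow_le_pow_left₀ (abs_nonneg _) (hMb n ω) 2
    have iMY : Integrable (M * Y n) Pr :=
      integrable_of_abs_le ((hM' n).mul (hY' n)) (c := (∑ k ∈ Finset.range n, b k) * b n)
        fun ω => by
        rw [Pi.mul_apply, abs_mul]
        exact mul_le_mul (hMb n ω) (hb n ω) (abs_nonneg _) ((abs_nonneg _).trans (hMb n ω))
    have hsq : ∀ ω, |Y n ω ^ 2| ≤ b n ^ 2 := fun ω => by
      rw [abs_pow]
      exact pow_le_pow_left₀ (abs_nonneg _) (hb n ω) 2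
    have iY2 : Integrable (fun ω => Y n ω ^ 2) Pr :=
      integrable_of_abs_le ((hY' n).pow_const 2) hsq
    have iY : Integrable (Y n) Pr := integrable_of_abs_le (hY' n) (hb n)
    have hz : ∫ ω, (M * Y n) ω ∂Pr = 0 := by
      rw [← integral_condExp (ℱ.le n)]
      have := condExp_mul_of_stronglyMeasurable_left (μ := Pr) (m := ℱ n) (f := M) (g := Y n)
        (hM n).stronglyMeasurable iMY iY
      rw [integral_congr_ae (g := fun _ => (0 : ℝ)), integral_zero]
      filter_upwards [this, h0 n] with ω h1 h2
      rw [h1, Pi.mul_apply, h2]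
      simp
    have e : ∀ ω, (∑ k ∈ Finset.range (n + 1), Y k ω) ^ 2
        = M ω ^ 2 + 2 * (M * Y n) ω + Y n ω ^ 2 := fun ω => by
      rw [Finset.sum_range_succ, Pi.mul_apply, hMdef]
      ring
    simp_rw [e]
    have i3 : Integrable (fun ω => M ω ^ 2 + 2 * (M * Y n) ω) Pr := iM2.add (iMY.const_mul 2)
    rw [integral_add i3 iY2, integral_add iM2 (iMY.const_mul 2),
      integral_const_mul, hz, Finset.sum_range_succ]
    have := (le_abs_self _).trans (abs_integral_le_of_abs_le (ν := Pr) hsq)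
    linarith

/-- The partial sums form a martingale bounded in `L²`, hence in `L¹` by `|M| ≤ 1 + M ^ 2`; it
converges almost surely, and convergent sequences are bounded. -/
lemma ae_exists_abs_sum_le [IsProbabilityMeasure Pr] {ℱ : Filtration ℕ m0}
    {Y : ℕ → Ω → ℝ} {b : ℕ → ℝ} (hY : ∀ k, Measurable[ℱ (k + 1)] (Y k))
    (hb : ∀ k ω, |Y k ω| ≤ b k) (h0 : ∀ k, Pr[Y k | ℱ k] =ᵐ[Pr] 0)
    (hs : Summable fun k => b k ^ 2) :
    ∀ᵐ ω ∂Pr, ∃ K, ∀ n, |∑ k ∈ Finset.range n, Y k ω| ≤ K := by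
  set M : ℕ → Ω → ℝ := fun n ω => ∑ k ∈ Finset.range n, Y k ω with hMdef
  have hM : ∀ n, Measurable[ℱ n] (M n) := fun n =>
    Finset.measurable_sum _ fun k hk =>
      (hY k).mono (ℱ.mono (Finset.mem_range.1 hk)) le_rfl
  have hM' : ∀ n, Measurable (M n) := fun n => (hM n).mono (ℱ.le _) le_rfl
  have hMb : ∀ n ω, |M n ω| ≤ ∑ k ∈ Finset.range n, b k := fun n ω =>
    (Finset.abs_sum_le_sum_abs _ _).trans (Finset.sum_le_sum fun k _ => hb k ω)
  have iM : ∀ n, Integrable (M n) Pr := fun n => integrable_of_abs_le (hM' n) (hMb n)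
  have mart : Martingale M ℱ Pr := by
    refine martingale_of_condExp_sub_eq_zero_nat (fun n => (hM n).stronglyMeasurable) iM
      fun n => ?_
    have : M (n + 1) - M n = Y n := by
      ext ω
      simp [hMdef, Finset.sum_range_succ]
    rw [this]
    exact h0 n
  have hbd : ∀ n, eLpNorm (M n) 1 Pr ≤ ((1 + ∑' k, b k ^ 2).toNNReal : ℝ≥0∞) := fun n => by
    rw [eLpNorm_one_eq_lintegral_enorm, ← ofReal_integral_norm_eq_lintegral_enorm (iM n)]
    refine ENNReal.ofReal_le_ofReal ?_
    have i2 : Integrable (fun ω => M n ω ^ 2) Pr :=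
      integrable_of_abs_le ((hM' n).pow_const 2) (c := (∑ k ∈ Finset.range n, b k) ^ 2) fun ω => by
        rw [abs_pow]
        exact pow_le_pow_left₀ (abs_nonneg _) (hMb n ω) 2
    calc ∫ ω, ‖M n ω‖ ∂Pr ≤ ∫ ω, (1 + M n ω ^ 2) ∂Pr := by
          refine integral_mono (iM n).norm ((integrable_const 1).add i2) fun ω => ?_
          simp only [Real.norm_eq_abs]
          nlinarith [sq_abs (M n ω), sq_nonneg (|M n ω| - 1)]
      _ = 1 + ∫ ω, M n ω ^ 2 ∂Pr := by
          rw [integral_add (integrable_const 1) i2]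
          simp
      _ ≤ 1 + ∑' k, b k ^ 2 := by
          gcongr
          exact (integral_sq_sum_le hY hb h0 n).trans
            (hs.sum_le_tsum _ fun k _ => sq_nonneg _)
  filter_upwards [mart.submartingale.exists_ae_tendsto_of_bdd hbd] with ω ⟨c, hc⟩
  obtain ⟨K, hK⟩ := hc.abs.bddAbove_range
  exact ⟨K, fun n => hK ⟨n, rfl⟩⟩

end Martingale

/-! ### Weighted sums along the chain -/

/-- Summation by parts: the boundary terms cost `C * β 0 + C * β n`, and the differences of the
antitone weights telescope to `C * (β 0 - β n)`. -/
lemma abs_sum_mul_sub_le {β u : ℕ → ℝ} {C : ℝ} (hβ : Antitone β) (hβ0 : ∀ k, 0 ≤ β k)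
    (hu : ∀ k, |u k| ≤ C) (n : ℕ) :
    |∑ k ∈ Finset.range n, β k * (u k - u (k + 1))| ≤ 2 * C * β 0 := by
  have e : ∑ k ∈ Finset.range n, β k * (u k - u (k + 1))
      = β 0 * u 0 - β n * u n - ∑ k ∈ Finset.range n, (β k - β (k + 1)) * u (k + 1) := by
    induction n with
    | zero => simp
    | succ n ih =>
      rw [Finset.sum_range_succ, Finset.sum_range_succ, ih]
      ring
  have h1 : |∑ k ∈ Finset.range n, (β k - β (k + 1)) * u (k + 1)| ≤ (β 0 - β n) * C := by
    rw [← Finset.sum_range_sub', Finset.sum_mul]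
    refine (Finset.abs_sum_le_sum_abs _ _).trans (Finset.sum_le_sum fun k _ => ?_)
    have := sub_nonneg.2 (hβ k.le_succ)
    rw [abs_mul, abs_of_nonneg this]
    exact mul_le_mul_of_nonneg_left (hu _) this
  have h2 : ∀ k, |β k * u k| ≤ β k * C := fun k => by
    rw [abs_mul, abs_of_nonneg (hβ0 k)]
    exact mul_le_mul_of_nonneg_left (hu _) (hβ0 k)
  rw [e, abs_le]
  have a := abs_le.1 h1
  have b := abs_le.1 (h2 0)
  have c := abs_le.1 (h2 n)
  constructor <;> linarith

section Chain

variable {Ω S : Type*} [MeasurableSpace Ω] [MeasurableSpace S] {Pr : Measure Ω}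
  {P : Kernel S S} {X : ℕ → Ω → S}

/-- Square-summable weighted sums of a centred bounded function along a uniformly ergodic chain
are almost surely bounded. -/
theorem IsMarkovChain.ae_exists_abs_sum_le [IsProbabilityMeasure Pr] [IsMarkovKernel P]
    {μ : Measure S} [IsProbabilityMeasure μ] (hP : UniformlyErgodic P μ)
    (hX : IsMarkovChain P X Pr) {f : S → ℝ} {c L : ℝ} (hf : Measurable f) (hc : ∀ x, |f x| ≤ c)
    (hL : Tendsto (fun t => ∫ ω, f (X t ω) ∂Pr) atTop (𝓝 L))
    {β : ℕ → ℝ} (hβ : Antitone β) (hβ0 : ∀ k, 0 ≤ β k) (hβs : Summable fun k => β k ^ 2) :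
    ∀ᵐ ω ∂Pr, ∃ K, ∀ n, |∑ k ∈ Finset.range n, β k * (f (X (k + 1) ω) - L)| ≤ K := by
  have hLμ : L = ∫ x, f x ∂μ := tendsto_nhds_unique hL (hX.tendsto_integral hP hf hc)
  obtain ⟨h, C, hm, hC, hpois⟩ := hP.exists_poisson (g := fun x => f x - L) (c := c + |L|)
    (hf.sub_const L) (fun x => (abs_sub _ _).trans (add_le_add_left (hc x) _)) (by
      rw [integral_sub (integrable_of_abs_le hf hc) (integrable_const _), integral_const,
        probReal_univ, one_smul, hLμ, sub_self])
  -- The shift by one makes `h (X (k + 2))` measurable for `ℱ (k + 1)`, while `X (k + 1)` is known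
  -- at `ℱ k`.
  let ℱ : Filtration ℕ (inferInstance : MeasurableSpace Ω) :=
    { seq := fun n => past X (n + 1)
      mono' := fun i j hij => past_mono X (Nat.succ_le_succ hij)
      le' := fun n => hX.past_le _ }
  have mP := measurable_integral_kernel P hm
  have hPC : ∀ x, |∫ y, h y ∂P x| ≤ C := fun x => abs_integral_le_of_abs_le hC
  have hcond : ∀ k, Pr[fun ω => β k * (h (X (k + 2) ω) - ∫ y, h y ∂P (X (k + 1) ω)) | ℱ k]
      =ᵐ[Pr] 0 := by
    intro k
    have i1 : Integrable (fun ω => h (X (k + 2) ω)) Pr :=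
      integrable_of_abs_le (hm.comp (hX.measurable _ (by omega))) fun ω => hC _
    have m2 : Measurable[ℱ k] fun ω => ∫ y, h y ∂P (X (k + 1) ω) :=
      mP.comp (measurable_past X (by omega) le_rfl)
    have i2 : Integrable (fun ω => ∫ y, h y ∂P (X (k + 1) ω)) Pr :=
      integrable_of_abs_le (m2.mono (ℱ.le k) le_rfl) fun ω => hPC _
    have s1 := condExp_smul (μ := Pr) (β k)
      ((fun ω => h (X (k + 2) ω)) - fun ω => ∫ y, h y ∂P (X (k + 1) ω)) (ℱ k)
    have s2 := condExp_sub i1 i2 (ℱ k)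
    have s3 := hX.condExp_eq (t := k + 1) (by omega) hm hC
    have s4 := condExp_of_stronglyMeasurable (ℱ.le k) m2.stronglyMeasurable i2
    filter_upwards [s1, s2, s3] with ω h1 h2 h3
    refine h1.trans ?_
    rw [Pi.smul_apply, h2, Pi.sub_apply, s4]
    exact (congrArg (β k • ·) (sub_eq_zero.2 h3)).trans (smul_zero _)
  have hY := LSA.ae_exists_abs_sum_le (Pr := Pr) (ℱ := ℱ)
    (Y := fun k ω => β k * (h (X (k + 2) ω) - ∫ y, h y ∂P (X (k + 1) ω)))
    (b := fun k => β k * (C + C))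
    (fun k => ((hm.comp (measurable_past X (by omega) le_rfl)).sub
      (mP.comp (measurable_past X (by omega) (by omega)))).const_mul _)
    (fun k ω => by
      rw [abs_mul, abs_of_nonneg (hβ0 k)]
      exact mul_le_mul_of_nonneg_left ((abs_sub _ _).trans (add_le_add (hC _) (hPC _))) (hβ0 k))
    hcond (by simp_rw [mul_pow]; exact hβs.mul_right _)
  filter_upwards [hY] with ω ⟨K, hK⟩
  refine ⟨K + 2 * C * β 0, fun n => ?_⟩
  -- By the Poisson equation `f - L = h - P h`; adding and subtracting `h (X (k + 2))` leaves a
  -- martingale difference and a telescoping difference.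
  have e : ∑ k ∈ Finset.range n, β k * (f (X (k + 1) ω) - L)
      = ∑ k ∈ Finset.range n, β k * (h (X (k + 2) ω) - ∫ y, h y ∂P (X (k + 1) ω))
        + ∑ k ∈ Finset.range n, β k * (h (X (k + 1) ω) - h (X (k + 1 + 1) ω)) := by
    rw [← Finset.sum_add_distrib]
    refine Finset.sum_congr rfl fun k _ => ?_
    rw [← hpois]
    ring
  rw [e]
  exact (abs_add_le _ _).trans (add_le_add (hK n)
    (abs_sum_mul_sub_le (u := fun k => h (X (k + 1) ω)) hβ hβ0 (fun k => hC _) n))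

end Chain

/-! ### Deterministic analysis: tails and contractive recursions -/

/-- Abel summation: weights tending monotonically to zero turn bounded partial sums into tails that
are dominated by the weights. -/
lemma exists_tail_of_abs_sum_le {u y : ℕ → ℝ} {K : ℝ} (hu : Antitone u)
    (hu0 : Tendsto u atTop (𝓝 0)) (hy : ∀ n, |∑ k ∈ Finset.range n, y k| ≤ K) :
    ∃ N : ℕ → ℝ, (∀ k, N k - N (k + 1) = u k * y k) ∧ ∀ k, |N k| ≤ 2 * K * u k := by
  have hun : ∀ k, 0 ≤ u k := fun k => hu.le_of_tendsto hu0 k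
  set T : ℕ → ℝ := fun n => -∑ k ∈ Finset.range n, y k with hT
  have hTK : ∀ n, |T n| ≤ K := fun n => by rw [hT, abs_neg]; exact hy n
  have hsum : ∀ k, HasSum (fun j => K * (u (k + j) - u (k + j + 1))) (K * u k) := fun k => by
    refine HasSum.mul_left K ?_
    rw [hasSum_iff_tendsto_nat_of_nonneg fun j => sub_nonneg.2 (hu (Nat.le_succ _))]
    have : ∀ n, ∑ j ∈ Finset.range n, (u (k + j) - u (k + j + 1)) = u k - u (k + n) := fun n =>
      Finset.sum_range_sub' (fun j => u (k + j)) n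
    simp_rw [this]
    have h2 : Tendsto (fun n => u (k + n)) atTop (𝓝 0) := by
      simp_rw [add_comm k]
      exact (tendsto_add_atTop_iff_nat k).2 hu0
    simpa using h2.const_sub (u k)
  have hb : ∀ k j, ‖(u (k + j + 1) - u (k + j)) * T (k + j + 1)‖ ≤
      K * (u (k + j) - u (k + j + 1)) := fun k j => by
    have := sub_nonneg.2 (hu (Nat.le_succ (k + j)))
    rw [Real.norm_eq_abs, abs_mul, abs_sub_comm, abs_of_nonneg this, mul_comm]
    exact mul_le_mul_of_nonneg_right (hTK _) this
  have hs : ∀ k, Summable fun j => (u (k + j + 1) - u (k + j)) * T (k + j + 1) := fun k =>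
    Summable.of_norm_bounded (hsum k).summable (hb k)
  -- This is `∑_{j ≥ k} u j * y j` after summation by parts with `y j = T j - T (j + 1)`. The
  -- rearranged series converges absolutely, which the original one need not do.
  refine ⟨fun k => u k * T k + ∑' j, (u (k + j + 1) - u (k + j)) * T (k + j + 1), fun k => ?_,
    fun k => ?_⟩
  · have e : ∑' j, (u (k + j + 1) - u (k + j)) * T (k + j + 1) = (u (k + 1) - u k) * T (k + 1)
        + ∑' j, (u (k + 1 + j + 1) - u (k + 1 + j)) * T (k + 1 + j + 1) := by
      rw [(hs k).tsum_eq_zero_add]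
      refine congrArg₂ _ rfl (tsum_congr fun j => ?_)
      rw [show k + (j + 1) = k + 1 + j by omega]
    beta_reduce
    rw [e]
    have : T (k + 1) = T k - y k := by
      simp only [hT, Finset.sum_range_succ]
      ring
    rw [this]
    ring
  · have h1 := tsum_of_norm_bounded (hsum k) (hb k)
    rw [Real.norm_eq_abs] at h1
    have h2 : |u k * T k| ≤ u k * K := by
      rw [abs_mul, abs_of_nonneg (hun k)]
      exact mul_le_mul_of_nonneg_left (hTK k) (hun k)
    refine (abs_add_le _ _).trans ?_
    linarith

/-- A contractive scalar recursion inherits the decay rate of its forcing term, if that rate is at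
most `1 / k` relative to steps that are large compared with `1 / k`. -/
lemma exists_le_mul_of_recursion {v α u : ℕ → ℝ} {c K : ℝ} (hc : 0 < c) (hK : 0 ≤ K)
    (hα : Tendsto α atTop (𝓝 0)) (hα' : Tendsto (fun k : ℕ => ((k : ℝ) + 2) * α k) atTop atTop)
    (hu : ∀ k, 0 < u k) (hu' : ∀ k : ℕ, u k * (1 - 1 / ((k : ℝ) + 2)) ≤ u (k + 1))
    (hv : ∀ᶠ k in atTop, v (k + 1) ≤ (1 - c * α k) * v k + α k * (K * u k)) :
    ∃ C, 0 ≤ C ∧ ∀ᶠ k in atTop, v k ≤ C * u k := by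
  have h1 : ∀ᶠ k in atTop, c * α k ≤ 1 := by
    have : Tendsto (fun k => c * α k) atTop (𝓝 (c * 0)) := hα.const_mul c
    rw [mul_zero] at this
    exact this.eventually_le_const one_pos
  obtain ⟨T, hT⟩ := eventually_atTop.1
    (hv.and (h1.and (hα'.eventually_ge_atTop (2 / c))))
  -- The first entry makes the forcing at most half of the contraction; the other half beats the
  -- loss `1 / (k + 2)` in `u`, by the choice of `T`. The second entry starts the induction.
  refine ⟨max (2 * K / c) (v T / u T), le_max_of_le_left (by positivity),
    eventually_atTop.2 ⟨T, fun k hk => ?_⟩⟩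
  set C := max (2 * K / c) (v T / u T) with hC
  have hCK : 2 * K ≤ C * c := (div_le_iff₀ hc).1 (le_max_left _ _)
  have hC0 : 0 ≤ C := le_max_of_le_left (by positivity)
  induction k, hk using Nat.le_induction with
  | base => exact (div_le_iff₀ (hu T)).1 (le_max_right _ _)
  | succ k hk ih =>
    obtain ⟨a1, a2, a3⟩ := hT k hk
    have hk2 : (0 : ℝ) < (k : ℝ) + 2 := by positivity
    have hα0 : 0 < α k := by
      have : 0 < ((k : ℝ) + 2) * α k := lt_of_lt_of_le (by positivity) a3
      exact (mul_pos_iff_of_pos_left hk2).1 this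
    have a4 : 1 / ((k : ℝ) + 2) ≤ c / 2 * α k := by
      rw [div_le_iff₀ hk2]
      rw [div_le_iff₀ hc] at a3
      linarith
    calc v (k + 1) ≤ (1 - c * α k) * v k + α k * (K * u k) := a1
      _ ≤ (1 - c * α k) * (C * u k) + α k * ((C * c / 2) * u k) := by
          have := mul_le_mul_of_nonneg_left ih (sub_nonneg.2 a2)
          have h3 := mul_le_mul_of_nonneg_right (show K ≤ C * c / 2 by linarith) (hu k).le
          have := mul_le_mul_of_nonneg_left h3 hα0.le
          linarith
      _ = C * (u k * (1 - c / 2 * α k)) := by ring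
      _ ≤ C * (u k * (1 - 1 / ((k : ℝ) + 2))) := by
          have := (hu k).le
          gcongr
      _ ≤ C * u (k + 1) := mul_le_mul_of_nonneg_left (hu' k) hC0

section Recursion

variable {E : Type*} [NormedAddCommGroup E] [NormedSpace ℝ E]

/-- Pathwise analysis of the recursion `Δ_{k+1} = Δ_k + α_k (A_k Δ_k + e_k)` when the noise series
have small tails: the corrected iterate `Δ + N Δ + n` follows the averaged dynamics. -/
theorem exists_norm_le_mul_of_recursion {Abar : E →L[ℝ] E} {A N : ℕ → E →L[ℝ] E}
    {e n Δ : ℕ → E} {α u : ℕ → ℝ} {a b c s₀ C₀ K : ℝ} (V : Seminorm ℝ E)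
    (hV1 : ∀ x, ‖x‖ ≤ V x) (hV2 : ∀ x, V x ≤ C₀ * ‖x‖) (hC₀ : 0 ≤ C₀) (hc : 0 < c) (hs₀ : 0 < s₀)
    (hV : ∀ s, 0 ≤ s → s ≤ s₀ → ∀ x, V (x + s • Abar x) ≤ (1 - c * s) * V x)
    (hA : ∀ k, ‖A k‖ ≤ a) (he : ∀ k, ‖e k‖ ≤ b) (hK : 0 ≤ K)
    (hN : ∀ k, ‖N k‖ ≤ K * u k) (hn : ∀ k, ‖n k‖ ≤ K * u k)
    (hN' : ∀ k, N k - N (k + 1) = α k • (A k - Abar)) (hn' : ∀ k, n k - n (k + 1) = α k • e k)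
    (hα0 : ∀ k, 0 ≤ α k) (hα : Tendsto α atTop (𝓝 0))
    (hα' : Tendsto (fun k : ℕ => ((k : ℝ) + 2) * α k) atTop atTop)
    (hu : ∀ k, 0 < u k) (hu0 : Tendsto u atTop (𝓝 0)) (hua : Antitone u)
    (hu' : ∀ k : ℕ, u k * (1 - 1 / ((k : ℝ) + 2)) ≤ u (k + 1))
    (hΔ : ∀ k, Δ (k + 1) = Δ k + α k • (A k (Δ k) + e k)) :
    ∃ C, ∀ᶠ k in atTop, ‖Δ k‖ ≤ C * u k := by
  have ha : 0 ≤ a := (norm_nonneg _).trans (hA 0)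
  have hb : 0 ≤ b := (norm_nonneg _).trans (he 0)
  set ψ : ℕ → E := fun k => Δ k + N k (Δ k) + n k with hψ
  set R : ℕ → E := fun k => N (k + 1) (A k (Δ k) + e k) - Abar (N k (Δ k) + n k) with hR
  set K' := K * (‖Abar‖ + a + b) with hK'
  have hK'0 : 0 ≤ K' := by positivity
  -- The increments of `N` and `n` replace `A k` by `Abar` and remove `e k`. What remains is `N (k +
  -- 1)` acting on the step of `Δ`, and `Abar` acting on the correction.
  have hstep : ∀ k, ψ (k + 1) = (ψ k + α k • Abar (ψ k)) + α k • R k := fun k => by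
    have h1 : N k (Δ k) = N (k + 1) (Δ k) + α k • (A k (Δ k) - Abar (Δ k)) := by
      have := congrArg (fun L : E →L[ℝ] E => L (Δ k)) (hN' k)
      simp only [sub_apply, smul_apply] at this
      rw [← this]
      abel
    have h2 : n k = n (k + 1) + α k • e k := by
      rw [← hn' k]
      abel
    have h3 : ψ k = Δ k + N (k + 1) (Δ k) + n (k + 1)
        + α k • (A k (Δ k) + e k - Abar (Δ k)) := by
      simp only [hψ]
      rw [h1, h2]
      module
    have h4 : Abar (ψ k) = Abar (Δ k) + Abar (N k (Δ k) + n k) := by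
      simp only [hψ, map_add]
      abel
    rw [h4, h3]
    simp only [hψ, hR]
    rw [hΔ k]
    simp only [map_add, map_smul]
    module
  have hRb : ∀ k, ‖R k‖ ≤ K' * u k * (‖Δ k‖ + 1) := fun k => by
    have h1 : ‖N (k + 1) (A k (Δ k) + e k)‖ ≤ K * u k * (a * ‖Δ k‖ + b) := by
      refine ((N (k + 1)).le_opNorm _).trans (mul_le_mul ((hN _).trans
        (mul_le_mul_of_nonneg_left (hua k.le_succ) hK)) ((norm_add_le _ _).trans
          (add_le_add (((A k).le_opNorm _).trans
            (mul_le_mul_of_nonneg_right (hA k) (norm_nonneg _))) (he k))) (norm_nonneg _) ?_)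
      exact mul_nonneg hK (hu k).le
    have h2 : ‖Abar (N k (Δ k) + n k)‖ ≤ ‖Abar‖ * (K * u k * ‖Δ k‖ + K * u k) := by
      refine (Abar.le_opNorm _).trans (mul_le_mul_of_nonneg_left ((norm_add_le _ _).trans
          (add_le_add (((N k).le_opNorm _).trans
            (mul_le_mul_of_nonneg_right (hN k) (norm_nonneg _))) (hn k))) (norm_nonneg _))
    have h3 : 0 ≤ K * u k * a := mul_nonneg (mul_nonneg hK (hu k).le) ha
    have h4 : 0 ≤ K * u k * b * ‖Δ k‖ :=
      mul_nonneg (mul_nonneg (mul_nonneg hK (hu k).le) hb) (norm_nonneg _)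
    refine (norm_sub_le _ _).trans ((add_le_add h1 h2).trans ?_)
    rw [hK']
    nlinarith
  have hlim : ∀ M ε : ℝ, 0 < ε → ∀ᶠ k in atTop, M * u k ≤ ε := fun M ε hε => by
    have : Tendsto (fun k => M * u k) atTop (𝓝 (M * 0)) := hu0.const_mul M
    rw [mul_zero] at this
    exact this.eventually_le_const hε
  -- Once `‖N k‖ ≤ 1 / 2`, the map `I + N k` can be inverted up to a factor `2`, so `ψ` controls
  -- `Δ`.
  have hΔψ : ∀ᶠ k in atTop, ‖Δ k‖ ≤ 2 * V (ψ k) + 2 * K * u k := by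
    filter_upwards [hlim K (1 / 2) (by norm_num)] with k hk
    have h1 : Δ k = ψ k - N k (Δ k) - n k := by
      simp only [hψ]
      abel
    have h2 : ‖N k (Δ k)‖ ≤ 1 / 2 * ‖Δ k‖ := ((N k).le_opNorm _).trans
      (mul_le_mul_of_nonneg_right ((hN k).trans hk) (norm_nonneg _))
    have h3 : ‖Δ k‖ ≤ ‖ψ k‖ + ‖N k (Δ k)‖ + ‖n k‖ := by
      conv_lhs => rw [h1]
      exact (norm_sub_le _ _).trans (add_le_add_left (norm_sub_le _ _) _)
    linarith [hV1 (ψ k), hn k]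
  -- The error term proportional to `V (ψ k)` carries a factor `u k → 0` and eventually uses only
  -- half of the contraction rate `c`.
  have hrec : ∀ᶠ k in atTop, V (ψ (k + 1)) ≤ (1 - c / 2 * α k) * V (ψ k)
      + α k * (2 * C₀ * K' * u k) := by
    filter_upwards [hΔψ, hlim K (1 / 2) (by norm_num), hlim (2 * C₀ * K') (c / 2) (by positivity),
      hα.eventually_le_const hs₀] with k h1 h2 h3 h4
    have h5 : V (R k) ≤ C₀ * (K' * u k * (2 * V (ψ k) + 2)) :=
      (hV2 _).trans (mul_le_mul_of_nonneg_left ((hRb k).trans (mul_le_mul_of_nonneg_left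
        (by linarith) (mul_nonneg hK'0 (hu k).le))) hC₀)
    have h6 : V (α k • R k) = α k * V (R k) := by
      rw [map_smul_eq_mul, Real.norm_of_nonneg (hα0 k)]
    have h7 : 2 * C₀ * K' * u k * V (ψ k) ≤ c / 2 * V (ψ k) :=
      mul_le_mul_of_nonneg_right h3 (apply_nonneg V _)
    have h8 : α k * V (R k) ≤ α k * (c / 2 * V (ψ k) + 2 * C₀ * K' * u k) :=
      mul_le_mul_of_nonneg_left (by linarith) (hα0 k)
    rw [hstep]
    have := map_add_le_add V (ψ k + α k • Abar (ψ k)) (α k • R k)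
    linarith [hV (α k) (hα0 k) h4 (ψ k)]
  obtain ⟨C, hC0, hC⟩ := exists_le_mul_of_recursion (v := fun k => V (ψ k)) (half_pos hc)
    (by positivity : (0 : ℝ) ≤ 2 * C₀ * K') hα hα' hu hu' hrec
  refine ⟨2 * C + 2 * K, ?_⟩
  filter_upwards [hC, hΔψ] with k h1 h2
  linarith

/-! ### Norms adapted to a Hurwitz matrix -/

/-- An operator with a power of norm at most `1 / 2` contracts an equivalent norm. -/
lemma exists_seminorm_contracting {B : E →L[ℝ] E} {m : ℕ} (hm : 1 ≤ m) (hB : ‖B ^ m‖ ≤ 1 / 2) :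
    ∃ (V : Seminorm ℝ E) (ρ C : ℝ), ρ < 1 ∧ 0 ≤ C ∧ (∀ x, ‖x‖ ≤ V x) ∧ (∀ x, V x ≤ C * ‖x‖) ∧
      ∀ x, V (B x) ≤ ρ * V x := by
  have hm' : (1 : ℝ) ≤ m := by exact_mod_cast hm
  -- Bernoulli's inequality gives `ρ ^ m ≥ 1 / 2 ≥ ‖B ^ m‖`. Applying `B` shifts the sum defining
  -- `V`, and the new last term is then dominated by the dropped first term `‖x‖`.
  set ρ : ℝ := 1 - 1 / (2 * m) with hρ
  have hq : 1 / (2 * (m : ℝ)) ≤ 1 / 2 := by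
    apply one_div_le_one_div_of_le <;> linarith
  have hq0 : 0 < 1 / (2 * (m : ℝ)) := by positivity
  have hρ0 : 0 < ρ := by linarith
  have hρm : 1 / 2 ≤ ρ ^ m := by
    have := one_add_mul_le_pow (a := -(1 / (2 * (m : ℝ)))) (by linarith) m
    have e : (m : ℝ) * (1 / (2 * m)) = 1 / 2 := by field_simp
    rw [← sub_eq_add_neg] at this
    linarith
  let V : Seminorm ℝ E := Seminorm.of
    (fun x => ∑ k ∈ Finset.range m, (ρ ^ k)⁻¹ * ‖(B ^ k) x‖)
    (fun x y => by
      rw [← Finset.sum_add_distrib]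
      refine Finset.sum_le_sum fun k _ => ?_
      rw [← mul_add, map_add]
      exact mul_le_mul_of_nonneg_left (norm_add_le _ _) (by positivity))
    (fun r x => by
      rw [Finset.mul_sum]
      refine Finset.sum_congr rfl fun k _ => ?_
      rw [map_smul, norm_smul]
      ring)
  have hVx : ∀ x, V x = ∑ k ∈ Finset.range m, (ρ ^ k)⁻¹ * ‖(B ^ k) x‖ := fun x => rfl
  refine ⟨V, ρ, ∑ k ∈ Finset.range m, (ρ ^ k)⁻¹ * ‖B ^ k‖, by linarith, by positivity,
    fun x => ?_, fun x => ?_, fun x => ?_⟩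
  · rw [hVx]
    have := Finset.single_le_sum (f := fun k => (ρ ^ k)⁻¹ * ‖(B ^ k) x‖)
      (fun k _ => by positivity) (Finset.mem_range.2 hm)
    simpa using this
  · rw [hVx, Finset.sum_mul]
    refine Finset.sum_le_sum fun k _ => ?_
    rw [mul_assoc]
    exact mul_le_mul_of_nonneg_left ((B ^ k).le_opNorm x) (by positivity)
  · have h1 : V (B x) = ρ * ∑ k ∈ Finset.range m, (ρ ^ (k + 1))⁻¹ * ‖(B ^ (k + 1)) x‖ := by
      rw [hVx, Finset.mul_sum]
      refine Finset.sum_congr rfl fun k _ => ?_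
      rw [pow_succ B, mul_apply_eq_comp, pow_succ ρ]
      field_simp
    have h2 := Finset.sum_range_succ' (fun k => (ρ ^ k)⁻¹ * ‖(B ^ k) x‖) m
    rw [Finset.sum_range_succ, ← hVx] at h2
    have h3 : (ρ ^ m)⁻¹ * ‖(B ^ m) x‖ ≤ ‖x‖ := by
      rw [inv_mul_le_iff₀ (by positivity)]
      refine ((B ^ m).le_opNorm x).trans (mul_le_mul_of_nonneg_right (hB.trans hρm)
        (norm_nonneg _))
    simp only [pow_zero, inv_one, one_mul, one_apply_eq_self] at h2
    rw [h1]
    exact mul_le_mul_of_nonneg_left (by linarith) hρ0.le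

/-- A shorter step is a convex combination of staying at `x` and making the full step `s₀`. -/
lemma seminorm_add_smul_le_of_contracting {V : Seminorm ℝ E} {M : E →L[ℝ] E} {s₀ ρ s : ℝ}
    (hs₀ : 0 < s₀) (hV : ∀ x, V (x + s₀ • M x) ≤ ρ * V x) (hs : 0 ≤ s) (hss : s ≤ s₀) (x : E) :
    V (x + s • M x) ≤ (1 - (1 - ρ) / s₀ * s) * V x := by
  have e : x + s • M x = (1 - s / s₀) • x + (s / s₀) • (x + s₀ • M x) := by
    rw [smul_add, smul_smul, div_mul_cancel₀ _ hs₀.ne']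
    module
  have h1 : 0 ≤ s / s₀ := by positivity
  have h2 : s / s₀ ≤ 1 := (div_le_one hs₀).2 hss
  rw [e]
  refine (map_add_le_add V _ _).trans ?_
  rw [map_smul_eq_mul, map_smul_eq_mul, Real.norm_of_nonneg h1,
    Real.norm_of_nonneg (sub_nonneg.2 h2)]
  have := mul_le_mul_of_nonneg_left (hV x) h1
  have e2 : (1 - ρ) / s₀ * s = s / s₀ * (1 - ρ) := by ring
  rw [e2]
  linarith

end Recursion

/-- Powers of an element of spectral radius less than one tend to zero. -/
lemma tendsto_pow_of_spectralRadius_lt_one {R : Type*} [NormedRing R] [NormedAlgebra ℂ R]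
    [CompleteSpace R] {a : R} (ha : spectralRadius ℂ a < 1) :
    Tendsto (fun n : ℕ => a ^ n) atTop (𝓝 0) := by
  obtain ⟨r, hr1, hr2⟩ := ENNReal.lt_iff_exists_nnreal_btwn.1 ha
  have hr : r < 1 := by exact_mod_cast hr2
  refine squeeze_zero_norm' (a := fun n : ℕ => (r : ℝ) ^ n) ?_
    (tendsto_pow_atTop_nhds_zero_of_lt_one r.2 hr)
  filter_upwards [(spectrum.pow_nnnorm_pow_one_div_tendsto_nhds_spectralRadius a).eventually
    (gt_mem_nhds hr1), eventually_gt_atTop 0] with n hn hn0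
  have h1 := ENNReal.rpow_le_rpow hn.le (Nat.cast_nonneg (α := ℝ) n)
  rw [← ENNReal.rpow_mul, one_div_mul_cancel (by positivity), ENNReal.rpow_one,
    ENNReal.rpow_natCast] at h1
  exact_mod_cast h1

/-- `‖1 + s z‖² = 1 + s (2 Re z + s |z|²)`, and the bracket is negative for small `s > 0`. -/
lemma eventually_norm_one_add_mul_lt {z : ℂ} (hz : z.re < 0) :
    ∀ᶠ s : ℝ in 𝓝[>] 0, ‖1 + (s : ℂ) * z‖ < 1 := by
  have h0 : 0 < Complex.normSq z := Complex.normSq_pos.2 fun h => by simp [h] at hz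
  have h1 : 0 < -2 * z.re / Complex.normSq z := div_pos (by linarith) h0
  filter_upwards [Ioo_mem_nhdsGT h1] with s hs
  have h2 : s * Complex.normSq z < -2 * z.re := (lt_div_iff₀ h0).1 hs.2
  have h3 : ‖1 + (s : ℂ) * z‖ ^ 2 = 1 + s * (2 * z.re + s * Complex.normSq z) := by
    rw [Complex.sq_norm, Complex.normSq_apply, Complex.normSq_apply]
    simp
    ring
  rw [← sq_lt_one_iff₀ (norm_nonneg _), h3]
  nlinarith [hs.1]

-- The spectrum is finite, so one small `s` moves every eigenvalue `1 + s z` into the open unit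
-- disc. Spectral mapping and Gelfand's formula then apply over `ℂ`, and taking real parts of
-- entries returns to `ℝ`.
open scoped Matrix.Norms.Operator in
lemma IsHurwitz.exists_tendsto_pow {d : ℕ} {M : Matrix (Fin d) (Fin d) ℝ} (hM : IsHurwitz M) :
    ∃ s : ℝ, 0 < s ∧ Tendsto (fun n : ℕ => (1 + s • M) ^ n) atTop (𝓝 0) := by
  rcases isEmpty_or_nonempty (Fin d) with hd | hd
  · exact ⟨1, one_pos, tendsto_const_nhds.congr fun n => Subsingleton.elim _ _⟩
  set Mc : Matrix (Fin d) (Fin d) ℂ := M.map (algebraMap ℝ ℂ) with hMc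
  have hfin : (spectrum ℂ Mc).Finite := Matrix.finite_spectrum Mc
  have hre : ∀ z ∈ spectrum ℂ Mc, z.re < 0 := fun z hz => hM z (by
    rwa [Module.End.hasEigenvalue_iff_mem_spectrum, Matrix.spectrum_toLin'])
  obtain ⟨s, hs, hs0⟩ := (((eventually_all_finite hfin).2 fun z hz =>
    eventually_norm_one_add_mul_lt (hre z hz)).and self_mem_nhdsWithin).exists
  refine ⟨s, hs0, ?_⟩
  have hrad : spectralRadius ℂ (1 + (s : ℂ) • Mc) < 1 := by
    refine spectrum.spectralRadius_lt_of_forall_lt (r := 1) _ fun z hz => ?_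
    have e : 1 + (s : ℂ) • Mc = Polynomial.aeval Mc (1 + Polynomial.C (s : ℂ) * Polynomial.X) := by
      simp [Algebra.smul_def]
    rw [e, spectrum.map_polynomial_aeval] at hz
    obtain ⟨w, hw, rfl⟩ := hz
    rw [← NNReal.coe_lt_coe]
    simpa using hs w hw
  have h1 := tendsto_pow_of_spectralRadius_lt_one hrad
  have h2 : ∀ n : ℕ, (1 + (s : ℂ) • Mc) ^ n = ((1 + s • M) ^ n).map (algebraMap ℝ ℂ) := fun n => by
    have : 1 + (s : ℂ) • Mc = (algebraMap ℝ ℂ).mapMatrix (1 + s • M) := by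
      ext i j
      by_cases hij : i = j <;> simp [hMc, hij]
    rw [this, ← map_pow]
    rfl
  refine tendsto_pi_nhds.2 fun i => tendsto_pi_nhds.2 fun j => ?_
  have h3 : Tendsto (fun n : ℕ => ((1 + (s : ℂ) • Mc) ^ n) i j) atTop (𝓝 0) :=
    tendsto_pi_nhds.1 (tendsto_pi_nhds.1 h1 i) j
  have h4 := (Complex.continuous_re.tendsto 0).comp h3
  refine h4.congr fun n => ?_
  rw [Function.comp_apply, h2, Matrix.map_apply]
  rfl

/-- The action of a real matrix on Euclidean space, as a continuous linear map. -/
noncomputable abbrev clm {d : ℕ} (M : Matrix (Fin d) (Fin d) ℝ) :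
    EuclideanSpace ℝ (Fin d) →L[ℝ] EuclideanSpace ℝ (Fin d) :=
  Matrix.toEuclideanCLM (𝕜 := ℝ) (n := Fin d) M

lemma clm_apply {d : ℕ} (M : Matrix (Fin d) (Fin d) ℝ) (v : EuclideanSpace ℝ (Fin d)) :
    clm M v = act M v := rfl

lemma IsHurwitz.exists_seminorm {d : ℕ} {M : Matrix (Fin d) (Fin d) ℝ} (hM : IsHurwitz M) :
    ∃ (V : Seminorm ℝ (EuclideanSpace ℝ (Fin d))) (c s₀ C : ℝ), 0 < c ∧ 0 < s₀ ∧ 0 ≤ C ∧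
      (∀ x, ‖x‖ ≤ V x) ∧ (∀ x, V x ≤ C * ‖x‖) ∧
      ∀ s, 0 ≤ s → s ≤ s₀ → ∀ x, V (x + s • clm M x) ≤ (1 - c * s) * V x := by
  obtain ⟨s, hs, hlim⟩ := hM.exists_tendsto_pow
  have hcont : Continuous (fun N : Matrix (Fin d) (Fin d) ℝ => clm N) :=
    LinearMap.continuous_of_finiteDimensional
      (Matrix.toEuclideanCLM (𝕜 := ℝ) (n := Fin d)).toAlgEquiv.toLinearMap
  have h1 := ((hcont.tendsto 0).comp hlim).norm
  simp only [map_zero, norm_zero] at h1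
  obtain ⟨m, hm, hm1⟩ := ((h1.eventually_le_const (by norm_num : (0 : ℝ) < 1 / 2)).and
    (eventually_ge_atTop 1)).exists
  simp only [Function.comp_apply, map_pow] at hm
  obtain ⟨V, ρ, C, hρ, hC, hV1, hV2, hV3⟩ := exists_seminorm_contracting hm1 hm
  refine ⟨V, (1 - ρ) / s, s, C, div_pos (by linarith) hs, hs, hC, hV1, hV2, fun t h0 ht x =>
    seminorm_add_smul_le_of_contracting hs (fun x => ?_) h0 ht x⟩
  have := hV3 x
  rw [map_add, map_one, map_smul] at this
  exact this

/-- A kernel vector is fixed by `I + s₀ M`, which strictly contracts `V`. -/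
lemma IsHurwitz.clm_injective {d : ℕ} {M : Matrix (Fin d) (Fin d) ℝ} (hM : IsHurwitz M) :
    Function.Injective (clm M) := by
  obtain ⟨V, c, s₀, C, hc, hs₀, -, hV1, -, hV⟩ := hM.exists_seminorm
  rw [injective_iff_map_eq_zero]
  intro x hx
  have h1 := hV s₀ hs₀.le le_rfl x
  rw [hx, smul_zero, add_zero] at h1
  have h2 : 0 < c * s₀ := mul_pos hc hs₀
  have h3 := hV1 x
  have h4 := norm_nonneg x
  rw [← norm_le_zero_iff]
  nlinarith

lemma abs_apply_le_frobNorm {d : ℕ} (M : Matrix (Fin d) (Fin d) ℝ) (i j : Fin d) :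
    |M i j| ≤ frobNorm M := by
  refine Real.abs_le_sqrt ?_
  refine le_trans ?_ (Finset.single_le_sum (f := fun i => ∑ j, M i j ^ 2)
    (fun i _ => Finset.sum_nonneg fun j _ => sq_nonneg _) (Finset.mem_univ i))
  exact Finset.single_le_sum (f := fun j => M i j ^ 2) (fun j _ => sq_nonneg _)
    (Finset.mem_univ j)

lemma norm_clm_le_frobNorm {d : ℕ} (M : Matrix (Fin d) (Fin d) ℝ) : ‖clm M‖ ≤ frobNorm M := by
  refine ContinuousLinearMap.opNorm_le_bound _ (Real.sqrt_nonneg _) fun v => ?_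
  have h0 : 0 ≤ ∑ i, ∑ j, M i j ^ 2 :=
    Finset.sum_nonneg fun i _ => Finset.sum_nonneg fun j _ => sq_nonneg _
  rw [EuclideanSpace.norm_eq, EuclideanSpace.norm_eq, frobNorm, ← Real.sqrt_mul h0, Finset.sum_mul]
  refine Real.sqrt_le_sqrt (Finset.sum_le_sum fun i _ => ?_)
  simp only [Real.norm_eq_abs, sq_abs]
  exact Finset.sum_mul_sq_le_sq_mul_sq Finset.univ (fun j => M i j) fun j => v j

lemma frobNorm_le_sum_abs {d : ℕ} (M : Matrix (Fin d) (Fin d) ℝ) :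
    frobNorm M ≤ ∑ i, ∑ j, |M i j| := by
  refine Real.sqrt_le_iff.2 ⟨by positivity, ?_⟩
  have h (s : Fin d → ℝ) (hs : ∀ i, 0 ≤ s i) : ∑ i, s i ^ 2 ≤ (∑ i, s i) ^ 2 :=
    Finset.sum_sq_le_sq_sum_of_nonneg fun i _ => hs i
  refine le_trans (Finset.sum_le_sum fun i _ => ?_) (h (fun i => ∑ j, |M i j|) fun i => by positivity)
  simpa using h (fun j => |M i j|) fun j => abs_nonneg _

lemma norm_le_sum_abs {d : ℕ} (v : EuclideanSpace ℝ (Fin d)) : ‖v‖ ≤ ∑ i, |v i| := by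
  rw [EuclideanSpace.norm_eq]
  refine Real.sqrt_le_iff.2 ⟨by positivity, ?_⟩
  exact Finset.sum_sq_le_sq_sum_of_nonneg fun i _ => abs_nonneg _

/-! ### Polynomial rates -/

section Rates

/-- The polynomial rate, shifted so that it is positive at zero. -/
noncomputable def rate (κ : ℝ) (k : ℕ) : ℝ := ((k : ℝ) + 1) ^ (-κ)

variable {κ : ℝ}

lemma rate_pos (k : ℕ) : 0 < rate κ k := Real.rpow_pos_of_pos (by positivity) _

lemma antitone_rate (hκ : 0 ≤ κ) : Antitone (rate κ) := fun i j hij => by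
  have : (i : ℝ) ≤ j := by exact_mod_cast hij
  exact Real.rpow_le_rpow_of_nonpos (by positivity) (by linarith) (by linarith)

lemma tendsto_natCast_add_one : Tendsto (fun k : ℕ => (k : ℝ) + 1) atTop atTop :=
  tendsto_atTop_add_const_right _ _ tendsto_natCast_atTop_atTop

lemma tendsto_rate (hκ : 0 < κ) : Tendsto (rate κ) atTop (𝓝 0) :=
  (tendsto_rpow_neg_atTop hκ).comp tendsto_natCast_add_one

/-- As `κ ≤ 1`, the ratio `(k + 1) / (k + 2) ≤ 1` is at most its `κ`-th power. -/
lemma rate_mul_le_rate_succ (h1 : κ ≤ 1) (k : ℕ) :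
    rate κ k * (1 - 1 / ((k : ℝ) + 2)) ≤ rate κ (k + 1) := by
  have hx : (0 : ℝ) < (k : ℝ) + 1 := by positivity
  have hy : (0 : ℝ) < (k : ℝ) + 2 := by positivity
  have e1 : 1 - 1 / ((k : ℝ) + 2) = ((k : ℝ) + 1) / (k + 2) := by
    field_simp
    ring
  have e2 : ((k + 1 : ℕ) : ℝ) + 1 = (k : ℝ) + 2 := by
    push_cast
    ring
  have h2 := Real.rpow_le_rpow_of_exponent_ge (div_pos hx hy)
    ((div_le_one hy).2 (by linarith)) h1
  rw [Real.rpow_one, Real.div_rpow hx.le hy.le] at h2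
  rw [rate, rate, e1, e2]
  refine (mul_le_mul_of_nonneg_left h2 (Real.rpow_pos_of_pos hx _).le).trans_eq ?_
  rw [Real.rpow_neg hx.le, Real.rpow_neg hy.le]
  have := (Real.rpow_pos_of_pos hx κ).ne'
  field_simp

lemma stepSize_succ (α₀ η : ℝ) (k : ℕ) : stepSize α₀ η (k + 1) = α₀ * rate η k := by
  rw [stepSize, rate, Real.rpow_neg (by positivity), div_eq_mul_inv]
  push_cast
  rfl

lemma rate_add (a b : ℝ) (k : ℕ) : rate (a + b) k = rate a k * rate b k := by
  rw [rate, rate, rate, neg_add, Real.rpow_add (by positivity)]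

lemma tendsto_mul_rate_atTop (h1 : κ < 1) :
    Tendsto (fun k : ℕ => ((k : ℝ) + 2) * rate κ k) atTop atTop := by
  refine tendsto_atTop_mono (fun k => ?_)
    ((tendsto_rpow_atTop (sub_pos.2 h1)).comp tendsto_natCast_add_one)
  have : ((k : ℝ) + 1) ^ (1 - κ) = ((k : ℝ) + 1) * rate κ k := by
    rw [sub_eq_add_neg, Real.rpow_add (by positivity), Real.rpow_one, rate]
  rw [Function.comp_apply, this]
  exact mul_le_mul_of_nonneg_right (by linarith) (rate_pos k).le

lemma summable_rate_sq (h : 1 / 2 < κ) : Summable fun k => rate κ k ^ 2 := by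
  have h1 : Summable fun k : ℕ => (k : ℝ) ^ (-(2 * κ)) :=
    Real.summable_nat_rpow.2 (by linarith)
  refine ((summable_nat_add_iff 1).2 h1).congr fun k => ?_
  rw [rate, ← Real.rpow_mul_natCast (by positivity)]
  push_cast
  congr 1
  ring

lemma isLittleO_rate {γ : ℝ} (hκ : 0 ≤ κ) (h : γ < κ) : rate κ =o[atTop] fun t : ℕ => (t : ℝ) ^ (-γ) := by
  have h1 : rate κ =O[atTop] fun t : ℕ => (t : ℝ) ^ (-κ) := by
    refine IsBigO.of_bound 1 ?_
    filter_upwards [eventually_gt_atTop 0] with t ht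
    have ht' : (0 : ℝ) < t := by exact_mod_cast ht
    rw [one_mul, Real.norm_of_nonneg (rate_pos t).le,
      Real.norm_of_nonneg (Real.rpow_nonneg ht'.le _)]
    exact Real.rpow_le_rpow_of_nonpos ht' (by linarith) (by linarith)
  refine h1.trans_isLittleO ?_
  refine isLittleO_of_tendsto' ?_ ?_
  · filter_upwards [eventually_gt_atTop 0] with t ht h0
    exact absurd h0 (Real.rpow_pos_of_pos (by exact_mod_cast ht) _).ne'
  · refine ((tendsto_rpow_neg_atTop (sub_pos.2 h)).comp tendsto_natCast_atTop_atTop).congr' ?_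
    filter_upwards [eventually_gt_atTop 0] with t ht
    rw [Function.comp_apply, ← Real.rpow_sub (by exact_mod_cast ht)]
    congr 1
    ring

end Rates

/-! ### Almost sure decay of the noise tails -/

section Chain

variable {Ω S : Type*} [MeasurableSpace Ω] [MeasurableSpace S] {Pr : Measure Ω}
  {P : Kernel S S} {X : ℕ → Ω → S}

/-- The tails of the step-size weighted noise series decay polynomially, almost surely. -/
theorem IsMarkovChain.ae_exists_tail [IsProbabilityMeasure Pr] [IsMarkovKernel P]
    {μ : Measure S} [IsProbabilityMeasure μ] (hP : UniformlyErgodic P μ)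
    (hX : IsMarkovChain P X Pr) {f : S → ℝ} {c L : ℝ} (hf : Measurable f) (hc : ∀ x, |f x| ≤ c)
    (hL : Tendsto (fun t => ∫ ω, f (X t ω) ∂Pr) atTop (𝓝 L))
    {α₀ η κ : ℝ} (hα₀ : 0 < α₀) (hκ : 0 < κ) (hκη : κ < η - 1 / 2) :
    ∀ᵐ ω ∂Pr, ∃ (N : ℕ → ℝ) (K : ℝ), 0 ≤ K ∧
      (∀ k, N k - N (k + 1) = stepSize α₀ η (k + 1) * (f (X (k + 1) ω) - L)) ∧
      ∀ k, |N k| ≤ K * rate κ k := by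
  -- The step size is split as `rate κ * (α₀ * rate (η - κ))`: since `η - κ > 1 / 2` the second
  -- factor is square summable, and the first becomes the tail rate.
  have hs : Summable fun k => (α₀ * rate (η - κ) k) ^ 2 := by
    simp_rw [mul_pow]
    exact (summable_rate_sq (by linarith)).mul_left _
  filter_upwards [hX.ae_exists_abs_sum_le hP hf hc hL
    ((antitone_rate (κ := η - κ) (by linarith)).const_mul hα₀.le)
    (fun k => (mul_pos hα₀ (rate_pos k)).le) hs] with ω ⟨K, hK⟩
  obtain ⟨N, hN1, hN2⟩ := exists_tail_of_abs_sum_le (antitone_rate hκ.le) (tendsto_rate hκ) hK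
  refine ⟨N, 2 * K, ?_, fun k => ?_, hN2⟩
  · exact nonneg_of_mul_nonneg_left ((abs_nonneg _).trans (hN2 0)) (rate_pos 0)
  · rw [hN1, stepSize_succ, show η = κ + (η - κ) by ring, rate_add]
    ring_nf

end Chain

end LSA

/-! ### The convergence theorem -/

open LSA

theorem proposition1
    {Ω S : Type*} [MeasurableSpace Ω] [MeasurableSpace S] {d : ℕ}
    (Pr : Measure Ω) [IsProbabilityMeasure Pr]
    -- the uniformly ergodic Markov chain `X 1, X 2, …`
    (P : Kernel S S) [IsMarkovKernel P] (μ : Measure S) [IsProbabilityMeasure μ]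
    (hP : LSA.UniformlyErgodic P μ)
    (X : ℕ → Ω → S) (hX : LSA.IsMarkovChain P X Pr)
    -- the observations: measurable, bounded, with limiting means `Abar` (Hurwitz) and `bbar`
    (A : S → Matrix (Fin d) (Fin d) ℝ) (b : S → EuclideanSpace ℝ (Fin d))
    (hAmeas : ∀ i j, Measurable fun x => A x i j) (hbmeas : Measurable b)
    (hAbdd : ∃ Amax : ℝ, ∀ x, LSA.frobNorm (A x) ≤ Amax)
    (hbbdd : ∃ bmax : ℝ, ∀ x, ‖b x‖ ≤ bmax)
    (Abar : Matrix (Fin d) (Fin d) ℝ) (bbar : EuclideanSpace ℝ (Fin d))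
    (hAbar : Tendsto (fun t : ℕ => Matrix.of fun i j => ∫ ω, A (X t ω) i j ∂Pr) atTop (𝓝 Abar))
    (hbbar : Tendsto (fun t : ℕ => ∫ ω, b (X t ω) ∂Pr) atTop (𝓝 bbar))
    (hHurwitz : LSA.IsHurwitz Abar)
    -- the step sizes `α₀ / t ^ η` and the exponent of the rate
    (α₀ η γ : ℝ) (hα₀ : 0 < α₀) (hη : η ∈ Set.Ioo (1 / 2 : ℝ) 1)
    (hγ : γ ∈ Set.Ioo (0 : ℝ) (η - 1 / 2))
    -- the iterates, with an arbitrary (possibly random) initial value `θ 0`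
    (θ : ℕ → Ω → EuclideanSpace ℝ (Fin d))
    (hθ : ∀ ω, LSA.IsLSA A b (LSA.stepSize α₀ η) (fun t => X t ω) (fun t => θ t ω)) :
    ∃ θstar : EuclideanSpace ℝ (Fin d),
      (∀ v : EuclideanSpace ℝ (Fin d), LSA.act Abar v = bbar ↔ v = θstar) ∧
      ∀ᵐ ω ∂Pr,
        ((fun t : ℕ => ‖θ t ω - θstar‖) =o[atTop] fun t : ℕ => (t : ℝ) ^ (-γ)) ∧
        ∃ R : ℝ, ∀ t : ℕ, ‖θ t ω‖ ≤ R := by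
  have hinj := hHurwitz.clm_injective
  obtain ⟨θstar, hstar⟩ := (LinearMap.injective_iff_surjective
    (f := (clm Abar : EuclideanSpace ℝ (Fin d) →ₗ[ℝ] EuclideanSpace ℝ (Fin d)))).1 hinj bbar
  have hstar : clm Abar θstar = bbar := hstar
  refine ⟨θstar, fun v => ⟨fun hv => hinj (hstar ▸ hv), fun hv => hv ▸ hstar⟩, ?_⟩
  obtain ⟨Amax, hAmax⟩ := hAbdd
  obtain ⟨bmax, hbmax⟩ := hbbdd
  -- The room between `γ` and `κ` turns the bound `O(t^{-κ})` into `o(t^{-γ})`.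
  obtain ⟨κ, hκ1, hκ2⟩ := exists_between hγ.2
  have hκ0 : 0 < κ := hγ.1.trans hκ1
  obtain ⟨V, c, s₀, C₀, hc, hs₀, hC₀, hV1, hV2, hV⟩ := hHurwitz.exists_seminorm
  have hA : ∀ᵐ ω ∂Pr, ∀ i j, ∃ (N : ℕ → ℝ) (K : ℝ), 0 ≤ K ∧
      (∀ k, N k - N (k + 1) = stepSize α₀ η (k + 1) * (A (X (k + 1) ω) i j - Abar i j)) ∧
      ∀ k, |N k| ≤ K * rate κ k :=
    ae_all_iff.2 fun i => ae_all_iff.2 fun j => hX.ae_exists_tail hP (hAmeas i j)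
      (fun x => (abs_apply_le_frobNorm _ i j).trans (hAmax x))
      (tendsto_pi_nhds.1 (tendsto_pi_nhds.1 hAbar i) j) hα₀ hκ0 hκ2
  have hb : ∀ᵐ ω ∂Pr, ∀ i, ∃ (N : ℕ → ℝ) (K : ℝ), 0 ≤ K ∧
      (∀ k, N k - N (k + 1) = stepSize α₀ η (k + 1) * (b (X (k + 1) ω) i - bbar i)) ∧
      ∀ k, |N k| ≤ K * rate κ k := by
    refine ae_all_iff.2 fun i => hX.ae_exists_tail hP (f := fun x => b x i) (c := bmax) ?_
      (fun x => (PiLp.norm_apply_le (b x) i).trans (hbmax x)) ?_ hα₀ hκ0 hκ2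
    · exact (EuclideanSpace.proj (𝕜 := ℝ) i).continuous.measurable.comp hbmeas
    · refine (((EuclideanSpace.proj (𝕜 := ℝ) i).continuous.tendsto bbar).comp hbbar).congr' ?_
      -- Only `t ≥ 1` is used because `X 0` need not be measurable.
      filter_upwards [eventually_ge_atTop 1] with t ht
      refine ((EuclideanSpace.proj (𝕜 := ℝ) i).integral_comp_comm (Integrable.of_bound
        (hbmeas.comp (hX.measurable t ht)).aestronglyMeasurable bmax
        (ae_of_all _ fun ω => hbmax _))).symm
  filter_upwards [hA, hb] with ω hAω hbω
  choose NA KA hKA0 hNA hKA using hAω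
  choose Nb Kb hKb0 hNb hKb using hbω
  obtain ⟨N, hN⟩ : ∃ N : ℕ → Matrix (Fin d) (Fin d) ℝ, ∀ k i j, N k i j = NA i j k :=
    ⟨fun k => Matrix.of fun i j => NA i j k, fun _ _ _ => rfl⟩
  set nb : ℕ → EuclideanSpace ℝ (Fin d) := fun k => WithLp.toLp 2 fun i => Nb i k with hnb
  set K1 := ∑ i, ∑ j, KA i j with hK1
  set K2 := ∑ i, Kb i with hK2
  have hK10 : 0 ≤ K1 := Finset.sum_nonneg fun i _ => Finset.sum_nonneg fun j _ => hKA0 i j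
  have hK20 : 0 ≤ K2 := Finset.sum_nonneg fun i _ => hKb0 i
  have hNle : ∀ k, ‖clm (N k)‖ ≤ K1 * rate κ k := fun k => by
    refine (norm_clm_le_frobNorm _).trans ((frobNorm_le_sum_abs _).trans ?_)
    rw [hK1, Finset.sum_mul]
    refine Finset.sum_le_sum fun i _ => ?_
    rw [Finset.sum_mul]
    exact Finset.sum_le_sum fun j _ => by
      rw [hN]
      exact hKA i j k
  have hnble : ∀ k, ‖nb k‖ ≤ K2 * rate κ k := fun k => by
    refine (norm_le_sum_abs _).trans ?_
    rw [hK2, Finset.sum_mul]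
    exact Finset.sum_le_sum fun i _ => hKb i k
  have hNsub : ∀ k, clm (N k) - clm (N (k + 1))
      = stepSize α₀ η (k + 1) • (clm (A (X (k + 1) ω)) - clm Abar) := fun k => by
    rw [← map_sub, ← map_sub, ← map_smul]
    congr 1
    ext i j
    rw [Matrix.sub_apply, hN, hN, hNA]
    rfl
  have hnbsub : ∀ k, nb k - nb (k + 1) = stepSize α₀ η (k + 1) • (b (X (k + 1) ω) - bbar) :=
    fun k => by
      ext i
      exact hNb i k
  have hα : ∀ k, stepSize α₀ η (k + 1) = α₀ * rate η k := stepSize_succ α₀ η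
  -- Since `Abar θstar = bbar`, the noise `e` equals `(A - Abar) θstar - (b - bbar)`, so its tail is
  -- the matrix tail applied to `θstar` minus the vector tail.
  obtain ⟨C, hC⟩ := exists_norm_le_mul_of_recursion (Abar := clm Abar)
    (A := fun k => clm (A (X (k + 1) ω))) (N := fun k => clm (N k))
    (e := fun k => clm (A (X (k + 1) ω)) θstar - b (X (k + 1) ω))
    (n := fun k => clm (N k) θstar - nb k) (Δ := fun k => θ k ω - θstar)
    (α := fun k => stepSize α₀ η (k + 1)) (u := rate κ) (a := Amax)
    (b := Amax * ‖θstar‖ + bmax) (K := K1 * (1 + ‖θstar‖) + K2) V hV1 hV2 hC₀ hc hs₀ hV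
    (fun k => (norm_clm_le_frobNorm _).trans (hAmax _))
    (fun k => (norm_sub_le _ _).trans (add_le_add ((ContinuousLinearMap.le_opNorm _ _).trans
      (mul_le_mul_of_nonneg_right ((norm_clm_le_frobNorm _).trans (hAmax _)) (norm_nonneg _)))
      (hbmax _)))
    (by positivity)
    (fun k => (hNle k).trans (mul_le_mul_of_nonneg_right (by
      nlinarith [norm_nonneg θstar]) (rate_pos k).le))
    (fun k => by
      refine (norm_sub_le _ _).trans ((add_le_add ((ContinuousLinearMap.le_opNorm _ _).trans
        (mul_le_mul_of_nonneg_right (hNle k) (norm_nonneg _))) (hnble k)).trans ?_)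
      nlinarith [mul_nonneg hK10 (rate_pos (κ := κ) k).le])
    hNsub
    (fun k => by
      have h1 := congrArg (fun L => L θstar) (hNsub k)
      simp only [sub_apply, smul_apply, hstar] at h1
      rw [sub_sub_sub_comm, h1, hnbsub k, ← smul_sub]
      congr 1
      abel)
    (fun k => by
      simp only [hα]
      exact (mul_pos hα₀ (rate_pos k)).le)
    (by
      simp_rw [hα]
      simpa using (tendsto_rate (by linarith [hη.1] : 0 < η)).const_mul α₀)
    (by
      simp_rw [hα, mul_left_comm _ α₀]
      exact (tendsto_mul_rate_atTop hη.2).const_mul_atTop hα₀)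
    rate_pos (tendsto_rate hκ0) (antitone_rate hκ0.le)
    (rate_mul_le_rate_succ (by linarith [hη.2]))
    (fun k => by
      have h1 : θ (k + 1) ω = _ := hθ ω k
      rw [h1, map_sub]
      simp only [clm_apply]
      module)
  have hO : (fun t : ℕ => ‖θ t ω - θstar‖) =o[atTop] fun t : ℕ => (t : ℝ) ^ (-γ) := by
    refine IsBigO.trans_isLittleO (IsBigO.of_bound C ?_) (isLittleO_rate hκ0.le hκ1)
    filter_upwards [hC] with k hk
    rwa [norm_norm, Real.norm_of_nonneg (rate_pos k).le]
  refine ⟨hO, ?_⟩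
  have h0 : Tendsto (fun t : ℕ => ‖θ t ω - θstar‖) atTop (𝓝 0) :=
    hO.trans_tendsto ((tendsto_rpow_neg_atTop hγ.1).comp tendsto_natCast_atTop_atTop)
  obtain ⟨R, hR⟩ := h0.bddAbove_range
  refine ⟨R + ‖θstar‖, fun t => ?_⟩
  have h1 := hR ⟨t, rfl⟩
  have h2 := norm_add_le (θ t ω - θstar) θstar
  rw [sub_add_cancel] at h2
  linarith
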